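/- Let $n \ge 1$. A minimal factorization of size $n$ is a tuple $F=(\tau_1,\dots,\tau_{n-1})$ of transpositions of $\{1,\dots,n\}$ such that $\tau_1\tau_2\cdots\tau_{n-1}$ is the $n$-cycle $(1,2,\dots,n)$ mapping $i$ to $i+1$ for $1 \le i \le n-1$ and $n$ to $1$; permutations are multiplied from left to right, that is, $\tau_1$ is applied first. Let $\mathscr F^{(n)}=(t_1,\dots,t_{n-1})$ be a uniformly random minimal factorization of size $n$. For $1 \le i \le n$, let $\mathbb T_i=\{1\le j\le n-1 : i\in t_j\}$ be the set of indices of the transpositions that move $i$ (a transposition being identified with a two-element set), and let $\mathbb M_i=\{1\le j\le n-1 : t_1\cdots t_{j-1}(i)\ne t_1\cdots t_j(i)\}$ be the set of indices of the transpositions that affect the trajectory of $i$. Then for every $1\le k\le n$ the following three random vectors of length $2k$ have the same law: $$(\#\mathbb T_1,\#\mathbb M_1,\#\mathbb T_2,\#\mathbb M_2,\dots,\#\mathbb T_k,\#\mathbb M_k),$$ $$(\#\mathbb M_n,\#\mathbb T_1,\#\mathbb M_1,\#\mathbb T_2,\dots,\#\mathbb M_{k-1},\#\mathbb T_k),$$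 $$(\#\mathbb M_k,\#\mathbb T_k,\dots,\#\mathbb M_2,\#\mathbb T_2,\#\mathbb M_1,\#\mathbb T_1).$$ In particular, $\#\mathbb T_i$ and $\#\mathbb M_i$ have the same law for every $1\le i\le n$. -/

import Mathlib

/-- The product of the first `k` entries of the tuple `F` of permutations of an `n`-element set.
Permutations are multiplied from left to right: `F 0` is applied first, then `F 1`, and so on
(for `Equiv.Perm` the right-most factor of a product acts first, hence the `reverse`). -/
def leftPartialProd {n : ℕ} (F : Fin (n - 1) → Equiv.Perm (Fin n)) (k : ℕ) :
    Equiv.Perm (Fin n) :=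
  ((List.ofFn F).take k).reverse.prod

open Classical in
/-- The minimal factorizations of size `n`: the tuples of `n - 1` transpositions whose product,
from left to right, is the `n`-cycle `(1, 2, …, n)`. The element `i : Fin n` stands for
`i + 1 ∈ {1, …, n}`, so that the cycle is `finRotate n`. -/
noncomputable def minimalFactorizations (n : ℕ) : Finset (Fin (n - 1) → Equiv.Perm (Fin n)) :=
  Finset.univ.filter fun F =>
    (∀ j, (F j).IsSwap) ∧ leftPartialProd F (n - 1) = finRotate n

theorem finRotate_eq_formPerm_finRange (n : ℕ) : finRotate n = (List.finRange n).formPerm := by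
  ext i
  have hi : (i : ℕ) < (List.finRange n).length := by simp
  have h := List.formPerm_apply_getElem (List.finRange n) (List.nodup_finRange n) i hi
  obtain _ | n := n
  · exact i.elim0
  · simp only [List.getElem_finRange, List.length_finRange, Fin.cast_mk, Fin.eta] at h
    rw [h]
    simp [Fin.val_add]

theorem minimalFactorizations_nonempty (n : ℕ) : (minimalFactorizations n).Nonempty := by
  set L : List (Equiv.Perm (Fin n)) :=
    (List.zipWith Equiv.swap (List.finRange n) (List.finRange n).tail).reverse with hL
  have hlen : L.length = n - 1 := by simp [hL]
  have hprod : L.reverse.prod = finRotate n := by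
    rw [finRotate_eq_formPerm_finRange, hL, List.reverse_reverse, List.formPerm]
  have hswap : ∀ g ∈ L, g.IsSwap := by
    intro g hg
    rw [hL, List.mem_reverse, List.mem_iff_getElem] at hg
    obtain ⟨m, hm, rfl⟩ := hg
    refine ⟨_, _, ?_, List.getElem_zipWith⟩
    simp
  refine ⟨fun j => L[(j : ℕ)]'(by rw [hlen]; exact j.2), ?_⟩
  have hof : List.ofFn (fun j : Fin (n - 1) => L[(j : ℕ)]'(by rw [hlen]; exact j.2)) = L := by
    apply List.ext_getElem
    · simp [hlen]
    · intro m h₁ h₂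
      simp
  simp only [minimalFactorizations, Finset.mem_filter, Finset.mem_univ, true_and]
  refine ⟨fun j => hswap _ (List.getElem_mem _), ?_⟩
  rw [leftPartialProd, hof, List.take_of_length_le hlen.le, hprod]

/-- The law of a uniform random minimal factorization of size `n`. -/
noncomputable def uniformMinimalFactorization (n : ℕ) :
    PMF (Fin (n - 1) → Equiv.Perm (Fin n)) :=
  PMF.uniformOfFinset (minimalFactorizations n) (minimalFactorizations_nonempty n)

/-- The set `T_i` of the indices of the transpositions that move `i`, i.e. that contain `i` when
a transposition is seen as a two-element set. The index `j : Fin (n - 1)` stands for the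
time `j + 1`. -/
def movingIndices {n : ℕ} (F : Fin (n - 1) → Equiv.Perm (Fin n)) (i : Fin n) :
    Finset (Fin (n - 1)) :=
  Finset.univ.filter fun j => i ∈ (F j).support

/-- The set `M_i` of the indices of the transpositions that affect the trajectory of `i`. -/
def trajectoryIndices {n : ℕ} (F : Fin (n - 1) → Equiv.Perm (Fin n)) (i : Fin n) :
    Finset (Fin (n - 1)) :=
  Finset.univ.filter fun j => leftPartialProd F (j : ℕ) i ≠ leftPartialProd F ((j : ℕ) + 1) i

/-- The vector `(#T_1, #M_1, #T_2, #M_2, …, #T_k, #M_k)`, written as `k` consecutive pairs. -/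
def symVector {n k : ℕ} (hk : k ≤ n) (F : Fin (n - 1) → Equiv.Perm (Fin n)) : Fin k → ℕ × ℕ :=
  fun i =>
    ((movingIndices F (Fin.castLE hk i)).card, (trajectoryIndices F (Fin.castLE hk i)).card)

/-- The vector `(#M_n, #T_1, #M_1, #T_2, …, #M_{k-1}, #T_k)`, written as `k` consecutive pairs;
the index that precedes `1` is `n`. -/
def shiftedSymVector {n k : ℕ} (hk : k ≤ n) (F : Fin (n - 1) → Equiv.Perm (Fin n)) :
    Fin k → ℕ × ℕ :=
  fun i =>
    ((trajectoryIndices F ((finRotate n).symm (Fin.castLE hk i))).card,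
      (movingIndices F (Fin.castLE hk i)).card)

/-- The vector `(#M_k, #T_k, …, #M_2, #T_2, #M_1, #T_1)`, written as `k` consecutive pairs. -/
def reversedSymVector {n k : ℕ} (hk : k ≤ n) (F : Fin (n - 1) → Equiv.Perm (Fin n)) :
    Fin k → ℕ × ℕ :=
  fun i =>
    ((trajectoryIndices F (Fin.castLE hk i.rev)).card,
      (movingIndices F (Fin.castLE hk i.rev)).card)

/-!
Write `s_j` for the product of the first `j` transpositions of a minimal factorization `F`, as a
function (`s_{j+1} = t_{j+1} ∘ s_j`), and `c` for the `n`-cycle. The time `j + 1` affects the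
trajectory of `i` exactly when `i` is moved by the transposition
`u_{j+1} = s_j⁻¹ s_{j+1} = s_j⁻¹ t_{j+1} s_j`, and `u_1 ∘ ⋯ ∘ u_{n-1} = c`. So replacing the `t_j`
by the `u_j` exchanges the two kinds of index sets, once the `u_j` are arranged so that their
product from left to right is again `c`. There are two ways to do this.

* Let `r` be a reflection of the cycle, i.e. `r c⁻¹ r⁻¹ = c`. The tuple `r u_j r⁻¹` has partial
  products `r s_j⁻¹ r⁻¹`, so it is a minimal factorization; its sets `T_i`, `M_i` are the sets
  `M`, `T` of `F` at `r⁻¹ i` (`reflectedDual`). A suitable reflection yields the reversed vector, and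
  the reflection that fixes `i` yields the equality in law of `#T_i` and `#M_i`.
* The tuple `c u_{n-j} c⁻¹` has partial products `c s_{n-1-j}⁻¹`, so it is a minimal
  factorization; up to reversal of time, its sets `T_i`, `M_i` are the sets `M_{i-1}`, `T_i` of `F`
  (`reversedDual`). This yields the shifted vector.

Both maps are injective because the partial products determine the factorization, so they permute
the finite set of minimal factorizations and preserve its uniform law.
-/

/-! ### Partial products and pulled back transpositions -/

section PartialProducts

variable {n : ℕ}

theorem leftPartialProd_zero (F : Fin (n - 1) → Equiv.Perm (Fin n)) :
    leftPartialProd F 0 = 1 := by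
  simp [leftPartialProd]

theorem leftPartialProd_succ (F : Fin (n - 1) → Equiv.Perm (Fin n)) (j : Fin (n - 1)) :
    leftPartialProd F (j + 1) = F j * leftPartialProd F j := by
  have hj : (j : ℕ) < (List.ofFn F).length := by simp
  rw [leftPartialProd, leftPartialProd, List.take_add_one, List.getElem?_eq_getElem hj]
  simp

theorem leftPartialProd_eq_of_forall_succ (F : Fin (n - 1) → Equiv.Perm (Fin n))
    (P : ℕ → Equiv.Perm (Fin n)) (h0 : P 0 = 1)
    (hs : ∀ j : Fin (n - 1), P (j + 1) = F j * P j) :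
    ∀ k ≤ n - 1, leftPartialProd F k = P k := by
  intro k
  induction k with
  | zero => intro _; rw [leftPartialProd_zero, h0]
  | succ k ih =>
    intro hk
    have h1 := leftPartialProd_succ F ⟨k, hk⟩
    have h2 := hs ⟨k, hk⟩
    simp only at h1 h2
    rw [h1, h2, ih (by omega)]

theorem eq_of_leftPartialProd_eq {F G : Fin (n - 1) → Equiv.Perm (Fin n)}
    (h : ∀ k ≤ n - 1, leftPartialProd F k = leftPartialProd G k) : F = G := by
  funext j
  have hj := j.2
  have h1 := h (j + 1) (by omega)
  rw [leftPartialProd_succ, leftPartialProd_succ, h j (by omega)] at h1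
  exact mul_right_cancel h1

theorem mem_minimalFactorizations {F : Fin (n - 1) → Equiv.Perm (Fin n)} :
    F ∈ minimalFactorizations n ↔
      (∀ j, (F j).IsSwap) ∧ leftPartialProd F (n - 1) = finRotate n := by
  simp [minimalFactorizations]

theorem Equiv.Perm.IsSwap.conj {α : Type*} [DecidableEq α] {f : Equiv.Perm α} (hf : f.IsSwap)
    (g : Equiv.Perm α) : (g * f * g⁻¹).IsSwap := by
  obtain ⟨x, y, hxy, rfl⟩ := hf
  exact ⟨g x, g y, g.injective.ne hxy, (Equiv.swap_apply_apply g x y).symm⟩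

theorem Equiv.Perm.IsSwap.inv_eq {α : Type*} [DecidableEq α] {f : Equiv.Perm α} (hf : f.IsSwap) :
    f⁻¹ = f := by
  obtain ⟨x, y, -, rfl⟩ := hf
  exact Equiv.swap_inv x y

/-- The transposition `s_j⁻¹ s_{j+1}`, the transposition of time `j` pulled back along the
trajectories: it moves exactly the elements whose trajectories are affected at that time. -/
def pulledBack (F : Fin (n - 1) → Equiv.Perm (Fin n)) (j : Fin (n - 1)) : Equiv.Perm (Fin n) :=
  (leftPartialProd F j)⁻¹ * leftPartialProd F (j + 1)

theorem isSwap_pulledBack {F : Fin (n - 1) → Equiv.Perm (Fin n)} {j : Fin (n - 1)}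
    (hF : (F j).IsSwap) : (pulledBack F j).IsSwap := by
  have h := hF.conj (leftPartialProd F j)⁻¹
  rwa [inv_inv, mul_assoc, ← leftPartialProd_succ] at h

theorem mem_support_conj_pulledBack (F : Fin (n - 1) → Equiv.Perm (Fin n)) (j : Fin (n - 1))
    (g : Equiv.Perm (Fin n)) (i : Fin n) :
    i ∈ (g * pulledBack F j * g⁻¹).support ↔ j ∈ trajectoryIndices F (g⁻¹ i) := by
  simp only [pulledBack, trajectoryIndices, Equiv.Perm.mem_support, Finset.mem_filter,
    Finset.mem_univ, true_and, Equiv.Perm.mul_apply, ne_eq]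
  rw [← Equiv.Perm.eq_inv_iff_eq (f := g), Equiv.Perm.inv_eq_iff_eq, eq_comm]

/-- The transposition at time `j` moves `i` if and only if the inverses of the partial products
change at `i` at that time. -/
theorem mem_movingIndices_iff_inv (F : Fin (n - 1) → Equiv.Perm (Fin n)) (j : Fin (n - 1))
    (i : Fin n) :
    j ∈ movingIndices F i ↔
      (leftPartialProd F j)⁻¹ i ≠ (leftPartialProd F (j + 1))⁻¹ i := by
  simp only [movingIndices, Equiv.Perm.mem_support, Finset.mem_filter,
    Finset.mem_univ, true_and, ne_eq]
  rw [leftPartialProd_succ, mul_inv_rev, Equiv.Perm.mul_apply,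
    (leftPartialProd F j)⁻¹.injective.eq_iff, Equiv.Perm.eq_inv_iff_eq]

end PartialProducts

/-! ### The dual factorization transported by a reflection -/

section Reflection

variable {n : ℕ}

/-- The pulled back transpositions of `F`, in the same order, conjugated by `r`. It is meant for
`r` a reflection, which conjugates the inverse of the `n`-cycle to the `n`-cycle. -/
def reflectedDual (r : Equiv.Perm (Fin n)) (F : Fin (n - 1) → Equiv.Perm (Fin n)) :
    Fin (n - 1) → Equiv.Perm (Fin n) :=
  fun j => r * pulledBack F j * r⁻¹

theorem leftPartialProd_reflectedDual (r : Equiv.Perm (Fin n))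
    {F : Fin (n - 1) → Equiv.Perm (Fin n)} (hF : ∀ j, (F j).IsSwap) :
    ∀ k ≤ n - 1, leftPartialProd (reflectedDual r F) k = r * (leftPartialProd F k)⁻¹ * r⁻¹ := by
  refine leftPartialProd_eq_of_forall_succ _ (fun k => r * (leftPartialProd F k)⁻¹ * r⁻¹) ?_ ?_
  · simp [leftPartialProd_zero]
  · intro j
    simp only [reflectedDual, pulledBack, leftPartialProd_succ, mul_inv_rev, (hF j).inv_eq]
    group

theorem reflectedDual_mem {r : Equiv.Perm (Fin n)} (hr : r * (finRotate n)⁻¹ * r⁻¹ = finRotate n)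
    {F : Fin (n - 1) → Equiv.Perm (Fin n)} (hF : F ∈ minimalFactorizations n) :
    reflectedDual r F ∈ minimalFactorizations n := by
  rw [mem_minimalFactorizations] at hF ⊢
  refine ⟨fun j => (isSwap_pulledBack (hF.1 j)).conj r, ?_⟩
  rw [leftPartialProd_reflectedDual r hF.1 _ le_rfl, hF.2, hr]

theorem reflectedDual_injOn (r : Equiv.Perm (Fin n)) :
    Set.InjOn (reflectedDual r) (minimalFactorizations n) := by
  intro F hF G hG h
  rw [Finset.mem_coe, mem_minimalFactorizations] at hF hG
  refine eq_of_leftPartialProd_eq fun k hk => ?_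
  have h1 := leftPartialProd_reflectedDual r hF.1 k hk
  rw [h, leftPartialProd_reflectedDual r hG.1 k hk] at h1
  exact (inv_injective (mul_left_cancel (mul_right_cancel h1))).symm

theorem movingIndices_reflectedDual (r : Equiv.Perm (Fin n))
    (F : Fin (n - 1) → Equiv.Perm (Fin n)) (i : Fin n) :
    movingIndices (reflectedDual r F) i = trajectoryIndices F (r⁻¹ i) := by
  ext j
  rw [← mem_support_conj_pulledBack]
  simp [movingIndices, reflectedDual]

theorem trajectoryIndices_reflectedDual (r : Equiv.Perm (Fin n))
    {F : Fin (n - 1) → Equiv.Perm (Fin n)} (hF : F ∈ minimalFactorizations n) (i : Fin n) :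
    trajectoryIndices (reflectedDual r F) i = movingIndices F (r⁻¹ i) := by
  rw [mem_minimalFactorizations] at hF
  ext j
  have hj := j.2
  rw [mem_movingIndices_iff_inv, trajectoryIndices, Finset.mem_filter,
    leftPartialProd_reflectedDual r hF.1 _ (by omega),
    leftPartialProd_reflectedDual r hF.1 _ (by omega)]
  simp only [Finset.mem_univ, true_and, Equiv.Perm.mul_apply, ne_eq, r.injective.eq_iff]

theorem subLeft_conj_finRotate_inv {m : ℕ} (a : Fin (m + 1)) :
    Equiv.subLeft a * (finRotate (m + 1))⁻¹ * (Equiv.subLeft a)⁻¹ = finRotate (m + 1) := by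
  rw [mul_inv_eq_iff_eq_mul, mul_inv_eq_iff_eq_mul]
  ext x
  simp only [Equiv.Perm.mul_apply, Equiv.subLeft_apply, finRotate_apply]
  congr 1
  abel

theorem subLeft_inv_apply {m : ℕ} (a x : Fin (m + 1)) :
    (Equiv.subLeft a)⁻¹ x = a - x := by
  rw [Equiv.Perm.inv_eq_iff_eq]
  simp

end Reflection

/-! ### The dual factorization with time reversed -/

section Reversal

variable {n : ℕ}

/-- The pulled back transpositions of `F`, in the reverse order, conjugated by the `n`-cycle. -/
def reversedDual (F : Fin (n - 1) → Equiv.Perm (Fin n)) :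
    Fin (n - 1) → Equiv.Perm (Fin n) :=
  fun j => finRotate n * pulledBack F j.rev * (finRotate n)⁻¹

theorem leftPartialProd_reversedDual {F : Fin (n - 1) → Equiv.Perm (Fin n)}
    (hF : leftPartialProd F (n - 1) = finRotate n) :
    ∀ k ≤ n - 1,
      leftPartialProd (reversedDual F) k = finRotate n * (leftPartialProd F (n - 1 - k))⁻¹ := by
  refine leftPartialProd_eq_of_forall_succ _
    (fun k => finRotate n * (leftPartialProd F (n - 1 - k))⁻¹) ?_ ?_
  · simp [hF]
  · intro j
    have hj := j.2
    have h1 : n - 1 - ((j : ℕ) + 1) = (j.rev : ℕ) := by rw [Fin.val_rev]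
    have h2 : n - 1 - (j : ℕ) = (j.rev : ℕ) + 1 := by rw [Fin.val_rev]; omega
    simp only [reversedDual, pulledBack, h1, h2]
    group

theorem reversedDual_mem {F : Fin (n - 1) → Equiv.Perm (Fin n)}
    (hF : F ∈ minimalFactorizations n) : reversedDual F ∈ minimalFactorizations n := by
  rw [mem_minimalFactorizations] at hF ⊢
  refine ⟨fun j => (isSwap_pulledBack (hF.1 j.rev)).conj _, ?_⟩
  rw [leftPartialProd_reversedDual hF.2 _ le_rfl, Nat.sub_self, leftPartialProd_zero, inv_one,
    mul_one]

theorem reversedDual_injOn :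
    Set.InjOn (reversedDual (n := n)) (minimalFactorizations n) := by
  intro F hF G hG h
  rw [Finset.mem_coe, mem_minimalFactorizations] at hF hG
  refine eq_of_leftPartialProd_eq fun k hk => ?_
  have h1 := leftPartialProd_reversedDual hF.2 (n - 1 - k) (by omega)
  rw [h, leftPartialProd_reversedDual hG.2 _ (by omega), Nat.sub_sub_self hk] at h1
  exact (inv_injective (mul_left_cancel h1)).symm

theorem card_movingIndices_reversedDual (F : Fin (n - 1) → Equiv.Perm (Fin n)) (i : Fin n) :
    (movingIndices (reversedDual F) i).card =
      (trajectoryIndices F ((finRotate n).symm i)).card := by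
  refine Finset.card_equiv Fin.revPerm fun j => ?_
  rw [Fin.revPerm_apply, ← Equiv.Perm.inv_def, ← mem_support_conj_pulledBack]
  simp [movingIndices, reversedDual]

theorem card_trajectoryIndices_reversedDual {F : Fin (n - 1) → Equiv.Perm (Fin n)}
    (hF : F ∈ minimalFactorizations n) (i : Fin n) :
    (trajectoryIndices (reversedDual F) i).card = (movingIndices F i).card := by
  rw [mem_minimalFactorizations] at hF
  refine Finset.card_equiv Fin.revPerm fun j => ?_
  have hj := j.2
  have h1 : n - 1 - ((j : ℕ) + 1) = (j.rev : ℕ) := by rw [Fin.val_rev]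
  have h2 : n - 1 - (j : ℕ) = (j.rev : ℕ) + 1 := by rw [Fin.val_rev]; omega
  rw [Fin.revPerm_apply, mem_movingIndices_iff_inv, trajectoryIndices, Finset.mem_filter,
    leftPartialProd_reversedDual hF.2 _ (by omega),
    leftPartialProd_reversedDual hF.2 _ (by omega), h1, h2]
  simp only [Finset.mem_univ, true_and, Equiv.Perm.mul_apply, ne_eq,
    (finRotate n).injective.eq_iff]
  rw [eq_comm]

end Reversal

/-! ### Invariance of the uniform law -/

/-- Two functions on a finite set have the same law under the uniform measure if an injective map
of the set to itself carries one to the other. -/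
theorem map_uniformOfFinset_eq_of_injOn {α β : Type*} {S : Finset α} (hS : S.Nonempty)
    (φ : α → α) (hmem : ∀ x ∈ S, φ x ∈ S) (hinj : Set.InjOn φ S) {f g : α → β}
    (hfg : ∀ x ∈ S, f (φ x) = g x) :
    (PMF.uniformOfFinset S hS).map f = (PMF.uniformOfFinset S hS).map g := by
  classical
  have himage : S.image φ = S :=
    Finset.eq_of_subset_of_card_le (Finset.image_subset_iff.2 hmem)
      (Finset.card_image_of_injOn hinj).ge
  have key : ∀ (h : α → β) (b : β), (PMF.uniformOfFinset S hS).map h b =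
      ∑ x ∈ S, if b = h x then (S.card : ENNReal)⁻¹ else 0 := by
    intro h b
    rw [PMF.map_apply, tsum_eq_sum (s := S)]
    · refine Finset.sum_congr rfl fun x hx => ?_
      rw [PMF.uniformOfFinset_apply_of_mem hS hx]
    · intro x hx
      rw [PMF.uniformOfFinset_apply_of_notMem hS hx, ite_self]
  ext b
  rw [key, key]
  conv_lhs => rw [← himage]
  rw [Finset.sum_image hinj, himage]
  exact Finset.sum_congr rfl fun x hx => by rw [hfg x hx]

theorem theorem3 (n : ℕ) :
    (∀ (k : ℕ) (_ : 1 ≤ k) (hk : k ≤ n),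
      (uniformMinimalFactorization n).map (symVector hk) =
          (uniformMinimalFactorization n).map (shiftedSymVector hk) ∧
        (uniformMinimalFactorization n).map (symVector hk) =
          (uniformMinimalFactorization n).map (reversedSymVector hk)) ∧
    ∀ i : Fin n,
      (uniformMinimalFactorization n).map (fun F => (movingIndices F i).card) =
        (uniformMinimalFactorization n).map (fun F => (trajectoryIndices F i).card) := by
  refine ⟨fun k h1 hk => ⟨?_, ?_⟩, fun i => ?_⟩
  · refine map_uniformOfFinset_eq_of_injOn _ reversedDual (fun F => reversedDual_mem)
      reversedDual_injOn fun F hF => ?_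
    funext i
    simp only [symVector, shiftedSymVector, card_movingIndices_reversedDual,
      card_trajectoryIndices_reversedDual hF]
  · obtain _ | m := n
    · omega
    -- On `0, …, k - 1` the reflection `x ↦ (k - 1) - x` is the reversal of the vector.
    set a : Fin (m + 1) := ⟨k - 1, by omega⟩ with ha
    refine map_uniformOfFinset_eq_of_injOn _ (reflectedDual (Equiv.subLeft a))
      (fun F => reflectedDual_mem (subLeft_conj_finRotate_inv a))
      (reflectedDual_injOn _) fun F hF => ?_
    funext i
    have hi := i.2
    have hrev : (Equiv.subLeft a)⁻¹ (Fin.castLE hk i) = Fin.castLE hk i.rev := by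
      rw [subLeft_inv_apply]
      apply Fin.ext
      rw [Fin.sub_val_of_le (by rw [Fin.le_def, ha, Fin.val_castLE]; simp only; omega),
        Fin.val_castLE, Fin.val_castLE, Fin.val_rev]
      simp only [ha]
      omega
    simp only [symVector, reversedSymVector, movingIndices_reflectedDual,
      trajectoryIndices_reflectedDual _ hF, hrev]
  · obtain _ | m := n
    · exact i.elim0
    -- The reflection `x ↦ 2 i - x` fixes `i`.
    refine map_uniformOfFinset_eq_of_injOn _ (reflectedDual (Equiv.subLeft (i + i)))
      (fun F => reflectedDual_mem (subLeft_conj_finRotate_inv _))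
      (reflectedDual_injOn _) fun F _ => ?_
    simp only [movingIndices_reflectedDual, subLeft_inv_apply, add_sub_cancel_right]
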